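/- All graphs are finite and simple. A set $S$ of vertices of a graph $G$ is an *indeque set* if the induced subgraph $G[S]$ is a disjoint union of cliques with no edges between different cliques; the *indeque number* of $G$ is the maximum size of an indeque set of $G$. A *path decomposition* of $G$ is a non-empty finite sequence of vertex sets (bags) $B_0,\dots,B_m$ such that every vertex lies in some bag, the two ends of every edge lie in a common bag, and $B_i\cap B_k\subseteq B_j$ whenever $i\le j\le k$. Its *width* is $\max_i|B_i|-1$ (taken to be $0$ if all bags are empty), and the *pathwidth* of $G$ is the least width of a path decomposition of $G$. For a class $\mathcal G$ of graphs containing a graph on $n$ vertices for every $n \geq 1$, let $f_{\mathcal G}(n)$ be the minimum indeque number of a graph in $\mathcal G$ with exactly $n$ vertices; if the limit $\lim_{n\to\infty} f_{\mathcal G}(n)/n$ exists, it is called the *indeque ratio* of $\mathcal G$. **Theorem.** Let $\mathcal P_2$ be the class of graphs of pathwidth at most $2$. 1. The indeque ratio of $\mathcal P_2$ exists and equals $1/2$, that is, $\lim_{n\to\infty} f_{\mathcal P_2}(n)/n=\tfrac12$. 2. Every graph of pathwidth at most $2$ on $n$ vertices has an indeque set of size at least $n/2$. 3. The bound in (2)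 is sharp: the $4$-cycle $C_4$ has pathwidth at most $2$ and indeque number exactly $2$. -/

import Mathlib

open Filter Topology

/-- `S` is an indeque set of `G`: the induced subgraph `G[S]` is a disjoint union of independent
cliques, that is, `S` splits into classes such that two distinct vertices of `S` are adjacent
if and only if they lie in the same class. -/
def SimpleGraph.IsIndeque {V : Type*} (G : SimpleGraph V) (S : Set V) : Prop :=
  ∃ r : Setoid S, ∀ u v : S, (G.induce S).Adj u v ↔ u ≠ v ∧ r u v

/-- The indeque number of a finite graph: the maximum size of an indeque set. -/
noncomputable def SimpleGraph.indequeNumber {V : Type*} (G : SimpleGraph V) : ℕ :=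
  sSup {k : ℕ | ∃ S : Finset V, G.IsIndeque (S : Set V) ∧ S.card = k}

/-- A path decomposition of `G`: a non-empty finite sequence of bags `bag 0, …, bag len`
covering all vertices and all edges, such that every vertex occupies an interval of bags. -/
structure SimpleGraph.PathDecomposition {V : Type*} (G : SimpleGraph V) where
  len : ℕ
  bag : Fin (len + 1) → Finset V
  vertex_mem : ∀ v : V, ∃ i, v ∈ bag i
  edge_mem : ∀ u v : V, G.Adj u v → ∃ i, u ∈ bag i ∧ v ∈ bag i
  interval : ∀ (v : V) (i j k : Fin (len + 1)), i ≤ j → j ≤ k →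
    v ∈ bag i → v ∈ bag k → v ∈ bag j

/-- The width of a path decomposition: the largest bag size minus one (read as `0` in the case
that all bags are empty, which happens only for the graph without vertices). -/
def SimpleGraph.PathDecomposition.width {V : Type*} {G : SimpleGraph V}
    (D : G.PathDecomposition) : ℕ :=
  (Finset.univ.sup fun i => (D.bag i).card) - 1

/-- The pathwidth of a finite graph: the least width of a path decomposition. -/
noncomputable def SimpleGraph.pathwidth {V : Type*} (G : SimpleGraph V) : ℕ :=
  sInf {w : ℕ | ∃ D : G.PathDecomposition, D.width = w}

/-- A class of finite graphs. -/
abbrev GraphClass := ∀ (V : Type) [Fintype V], Set (SimpleGraph V)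

/-- The least indeque number of a graph in the class with exactly `n` vertices. -/
noncomputable def GraphClass.indequeMin (𝒢 : GraphClass) (n : ℕ) : ℕ :=
  sInf {k : ℕ | ∃ (V : Type) (_ : Fintype V) (G : SimpleGraph V),
    G ∈ 𝒢 V ∧ Fintype.card V = n ∧ G.indequeNumber = k}

/-- The indeque ratio of the class, the limit of `indequeMin n / n`, exists and equals `c`. -/
def GraphClass.HasIndequeRatio (𝒢 : GraphClass) (c : ℝ) : Prop :=
  Tendsto (fun n : ℕ => (𝒢.indequeMin n : ℝ) / (n : ℝ)) atTop (𝓝 c)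

/-- The class of finite graphs of pathwidth at most `k`. -/
def pathwidthAtMost (k : ℕ) : GraphClass := fun _ _ => {G | G.pathwidth ≤ k}

/-!
A graph of pathwidth at most `2` has two vertices `a`, `b` with at most two neighbours outside
`{a, b}`: fix a path decomposition with bags of size at most `3` and let `a`, `b` be the first two
vertices whose intervals of bags end. Every other neighbour of `a` or `b` still lies in the last bag
of `b`, which besides `b` has room for two more vertices. Any two vertices form an indeque set, so
putting `a`, `b` into the set and discarding their other neighbours keeps at least half of the
vertices removed; repeating this on what is left gives an indeque set of size at least `n / 2`
(`SimpleGraph.PathDecomposition.exists_isIndeque_subset`).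

For the upper bound, cut `0, …, n - 1` into blocks of four consecutive numbers, each spanning a
`4`-cycle (`blockGraph`). Three vertices of a `4`-cycle induce a path, so an indeque set takes at
most two vertices from each block, hence at most `n / 2 + 2` in total.
-/

/-! ### Indeque sets and pathwidth -/

namespace SimpleGraph

variable {V : Type*} {G : SimpleGraph V}

/-- Indeque sets are the sets that contain no induced path on three vertices. -/
lemma isIndeque_iff {S : Set V} :
    G.IsIndeque S ↔ ∀ u ∈ S, ∀ v ∈ S, ∀ w ∈ S, G.Adj u v → G.Adj v w → u ≠ w → G.Adj u w := by
  constructor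
  · rintro ⟨r, hr⟩ u hu v hv w hw huv hvw huw
    have h1 := ((hr ⟨u, hu⟩ ⟨v, hv⟩).1 huv).2
    have h2 := ((hr ⟨v, hv⟩ ⟨w, hw⟩).1 hvw).2
    exact (hr ⟨u, hu⟩ ⟨w, hw⟩).2 ⟨fun h => huw (congrArg Subtype.val h), r.trans h1 h2⟩
  · intro h
    refine ⟨⟨fun u v => u = v ∨ G.Adj u v, ⟨fun _ => Or.inl rfl, ?_, ?_⟩⟩, ?_⟩
    · rintro u v (rfl | huv)
      · exact Or.inl rfl
      · exact Or.inr huv.symm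
    · rintro u v w (rfl | huv) (rfl | hvw)
      · exact Or.inl rfl
      · exact Or.inr hvw
      · exact Or.inr huv
      · by_cases huw : u = w
        · exact Or.inl huw
        · exact Or.inr (h u u.2 v v.2 w w.2 huv hvw fun h => huw (Subtype.ext h))
    · intro u v
      constructor
      · intro huv
        exact ⟨huv.ne, Or.inr huv⟩
      · rintro ⟨hne, rfl | huv⟩
        · exact absurd rfl hne
        · exact huv

lemma le_indequeNumber [Fintype V] {S : Finset V} (hS : G.IsIndeque (S : Set V)) :
    S.card ≤ G.indequeNumber :=
  le_csSup ⟨Fintype.card V, by rintro _ ⟨T, -, rfl⟩; exact T.card_le_univ⟩ ⟨S, hS, rfl⟩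

lemma indequeNumber_le {k : ℕ} (h : ∀ S : Finset V, G.IsIndeque (S : Set V) → S.card ≤ k) :
    G.indequeNumber ≤ k :=
  csSup_le' (by rintro _ ⟨S, hS, rfl⟩; exact h S hS)

lemma PathDecomposition.pathwidth_le (D : G.PathDecomposition) {k : ℕ}
    (h : ∀ i, (D.bag i).card ≤ k + 1) : G.pathwidth ≤ k := by
  have hle : G.pathwidth ≤ D.width := Nat.sInf_le ⟨D, rfl⟩
  refine hle.trans ?_
  have : (Finset.univ.sup fun i => (D.bag i).card) ≤ k + 1 := Finset.sup_le fun i _ => h i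
  unfold PathDecomposition.width
  omega

lemma exists_pathDecomposition_of_pathwidth_le [Fintype V] {k : ℕ} (h : G.pathwidth ≤ k) :
    ∃ D : G.PathDecomposition, ∀ i, (D.bag i).card ≤ k + 1 := by
  -- The one-bag decomposition shows that `pathwidth` is the infimum of a nonempty set.
  have hne : {w : ℕ | ∃ D : G.PathDecomposition, D.width = w}.Nonempty :=
    ⟨_, ⟨0, fun _ => Finset.univ, fun v => ⟨0, Finset.mem_univ v⟩,
      fun u v _ => ⟨0, Finset.mem_univ u, Finset.mem_univ v⟩,
      fun v _ _ _ _ _ _ _ => Finset.mem_univ v⟩, rfl⟩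
  obtain ⟨D, hD⟩ := Nat.sInf_mem hne
  refine ⟨D, fun i => ?_⟩
  have h1 := Finset.le_sup (f := fun i => (D.bag i).card) (Finset.mem_univ i)
  have h2 : D.width ≤ k := hD.trans_le h
  unfold PathDecomposition.width at h2
  omega

/-! ### Large indeque sets in graphs of pathwidth at most two -/

lemma PathDecomposition.exists_last (D : G.PathDecomposition) (v : V) :
    ∃ i, v ∈ D.bag i ∧ ∀ j, v ∈ D.bag j → j ≤ i := by
  classical
  obtain ⟨i₀, h₀⟩ := D.vertex_mem v
  obtain ⟨i, hi, hmax⟩ := (Finset.univ.filter fun i => v ∈ D.bag i).exists_max_image id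
    ⟨i₀, by simpa using h₀⟩
  exact ⟨i, by simpa using hi, fun j hj => hmax j (by simpa using hj)⟩

/-- If the bags have at most three elements, then every finite set `A` of vertices contains an
indeque set with at least half of the elements of `A`. -/
lemma PathDecomposition.exists_isIndeque_subset (D : G.PathDecomposition)
    (hD : ∀ i, (D.bag i).card ≤ 3) (A : Finset V) :
    ∃ S ⊆ A, G.IsIndeque (S : Set V) ∧ A.card ≤ 2 * S.card := by
  classical
  choose last hlast hmax using D.exists_last
  induction A using Finset.strongInduction with
  | H A ih =>
  by_cases hA : A.card ≤ 1
  · refine ⟨A, subset_rfl, isIndeque_iff.2 ?_, by omega⟩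
    intro u hu v hv w hw huv
    exact absurd (Finset.card_le_one.1 hA u hu v hv) huv.ne
  obtain ⟨a, ha, hamin⟩ := A.exists_min_image last (Finset.card_pos.1 (by omega))
  obtain ⟨b, hb, hbmin⟩ := (A.erase a).exists_min_image last
    (Finset.card_pos.1 (by rw [Finset.card_erase_of_mem ha]; omega))
  obtain ⟨hba, hbA⟩ := Finset.mem_erase.1 hb
  have hab := hamin b hbA
  set X := insert a (D.bag (last b)) with hX
  have hXcard : X.card ≤ 4 := (Finset.card_insert_le _ _).trans (by have := hD (last b); omega)
  have haX : a ∈ X := Finset.mem_insert_self _ _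
  have hbX : b ∈ X := Finset.mem_insert_of_mem (hlast b)
  -- A neighbour of `a` or `b` enters before the last bag of `b` and does not leave before it.
  have hnbr : ∀ x, x = a ∨ x = b → ∀ w ∈ A, G.Adj x w → w ∈ X := by
    intro x hx w hw hxw
    by_cases hwa : w = a
    · exact hwa ▸ haX
    obtain ⟨i, hxi, hwi⟩ := D.edge_mem x w hxw
    have hi : i ≤ last b := by
      rcases hx with rfl | rfl
      · exact (hmax _ _ hxi).trans hab
      · exact hmax _ _ hxi
    exact Finset.mem_insert_of_mem (D.interval w i (last b) (last w) hi
      (hbmin w (Finset.mem_erase.2 ⟨hwa, hw⟩)) hwi (hlast w))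
  obtain ⟨S, hSA, hS, hcard⟩ := ih (A \ X)
    (Finset.ssubset_iff_of_subset Finset.sdiff_subset |>.2
      ⟨a, ha, fun h => (Finset.mem_sdiff.1 h).2 haX⟩)
  have hSX : ∀ w ∈ S, w ∈ A ∧ w ∉ X := fun w hw => Finset.mem_sdiff.1 (hSA hw)
  have hsep : ∀ x, x = a ∨ x = b → ∀ w ∈ S, ¬ G.Adj x w := fun x hx w hw h =>
    (hSX w hw).2 (hnbr x hx w (hSX w hw).1 h)
  refine ⟨insert a (insert b S), ?_, ?_, ?_⟩
  · intro w hw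
    rcases Finset.mem_insert.1 hw with rfl | hw
    · exact ha
    rcases Finset.mem_insert.1 hw with rfl | hw
    · exact hbA
    exact (hSX w hw).1
  · rw [isIndeque_iff] at hS ⊢
    have hmem : ∀ w, w ∈ ((insert a (insert b S) : Finset V) : Set V) →
        (w = a ∨ w = b) ∨ w ∈ S := by
      intro w hw
      simpa [or_assoc] using hw
    intro u hu v hv w hw huv hvw huw
    rcases hmem v hv with hv | hv
    · -- Both `u` and `w` lie in `{a, b}` together with their neighbour `v`, so they coincide.
      have hu' := (hmem u hu).resolve_right fun h => hsep v hv u h huv.symm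
      have hw' := (hmem w hw).resolve_right fun h => hsep v hv w h hvw
      have := huv.ne
      have := hvw.ne
      grind
    · have hu' := (hmem u hu).resolve_left fun h => hsep u h v hv huv
      have hw' := (hmem w hw).resolve_left fun h => hsep w h v hv hvw.symm
      exact hS u hu' v hv w hw' huv hvw huw
  · have hbS : b ∉ S := fun h => (hSX b h).2 hbX
    have haS : a ∉ insert b S := by
      rw [Finset.mem_insert, not_or]
      exact ⟨fun h => hba h.symm, fun h => (hSX a h).2 haX⟩
    rw [Finset.card_insert_of_notMem haS, Finset.card_insert_of_notMem hbS]
    have := Finset.le_card_sdiff X A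
    omega

theorem exists_isIndeque_of_pathwidth_le_two [Fintype V] (h : G.pathwidth ≤ 2) :
    ∃ S : Finset V, G.IsIndeque (S : Set V) ∧ (Fintype.card V : ℝ) / 2 ≤ (S.card : ℝ) := by
  obtain ⟨D, hD⟩ := exists_pathDecomposition_of_pathwidth_le h
  obtain ⟨S, -, hS, hcard⟩ := D.exists_isIndeque_subset hD Finset.univ
  refine ⟨S, hS, ?_⟩
  rw [Finset.card_univ] at hcard
  have : (Fintype.card V : ℝ) ≤ 2 * S.card := by exact_mod_cast hcard
  linarith

end SimpleGraph

/-! ### Disjoint 4-cycles and the indeque ratio -/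

/-- The graph on `0, …, n - 1` whose blocks `4k, 4k + 1, 4k + 2, 4k + 3` each span a `4`-cycle,
taken as a complete bipartite graph between the even and the odd members; the last block may be
incomplete. -/
def blockGraph (n : ℕ) : SimpleGraph (Fin n) where
  Adj u v := (u : ℕ) / 4 = v / 4 ∧ (u : ℕ) % 2 ≠ v % 2
  symm := ⟨fun _ _ h => ⟨h.1.symm, h.2.symm⟩⟩
  loopless := ⟨fun _ h => h.2 rfl⟩

lemma blockGraph_adj {n : ℕ} {u v : Fin n} :
    (blockGraph n).Adj u v ↔ (u : ℕ) / 4 = v / 4 ∧ (u : ℕ) % 2 ≠ v % 2 := Iff.rfl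

/-- The block of `4k` has the two bags `2k` and `2k + 1`: both contain the odd members, and each
contains one of the even ones. -/
def blockGraphDecomposition (n : ℕ) : (blockGraph n).PathDecomposition where
  len := n
  bag j := Finset.univ.filter fun v : Fin n =>
    (v : ℕ) / 4 = (j : ℕ) / 2 ∧ ((v : ℕ) % 2 = 1 ∨ (v : ℕ) % 4 = 2 * ((j : ℕ) % 2))
  vertex_mem v := by
    refine ⟨⟨2 * ((v : ℕ) / 4) + (v : ℕ) % 4 / 2, by omega⟩, ?_⟩
    simp only [Finset.mem_filter, Finset.mem_univ, true_and]
    omega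
  edge_mem u v h := by
    rw [blockGraph_adj] at h
    -- The bag is determined by the even one of the two vertices.
    by_cases hu : (u : ℕ) % 2 = 0
    · refine ⟨⟨2 * ((u : ℕ) / 4) + (u : ℕ) % 4 / 2, by omega⟩, ?_⟩
      simp only [Finset.mem_filter, Finset.mem_univ, true_and]
      omega
    · refine ⟨⟨2 * ((v : ℕ) / 4) + (v : ℕ) % 4 / 2, by omega⟩, ?_⟩
      simp only [Finset.mem_filter, Finset.mem_univ, true_and]
      omega
  interval v i j k hij hjk hi hk := by
    simp only [Finset.mem_filter, Finset.mem_univ, true_and, Fin.le_def] at *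
    omega

lemma pathwidth_blockGraph_le (n : ℕ) : (blockGraph n).pathwidth ≤ 2 := by
  refine (blockGraphDecomposition n).pathwidth_le fun j => ?_
  have hsub : ((blockGraphDecomposition n).bag j).map Fin.valEmbedding ⊆
      {4 * ((j : ℕ) / 2) + 1, 4 * ((j : ℕ) / 2) + 3,
        4 * ((j : ℕ) / 2) + 2 * ((j : ℕ) % 2)} := by
    intro m hm
    obtain ⟨v, hv, rfl⟩ := Finset.mem_map.1 hm
    simp only [blockGraphDecomposition, Finset.mem_filter, Finset.mem_univ, true_and] at hv
    simp only [Fin.valEmbedding_apply, Finset.mem_insert, Finset.mem_singleton]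
    omega
  rw [← Finset.card_map Fin.valEmbedding]
  exact (Finset.card_le_card hsub).trans Finset.card_le_three

lemma indequeNumber_blockGraph_le (n : ℕ) :
    (blockGraph n).indequeNumber ≤ 2 * (n / 4 + 1) := by
  refine SimpleGraph.indequeNumber_le fun S hS => ?_
  rw [SimpleGraph.isIndeque_iff] at hS
  have hmaps : ∀ v ∈ S, (v : ℕ) / 4 ∈ Finset.range (n / 4 + 1) := by
    intro v _
    rw [Finset.mem_range]
    omega
  have hfiber : ∀ k ∈ Finset.range (n / 4 + 1),
      (S.filter fun v : Fin n => (v : ℕ) / 4 = k).card ≤ 2 := by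
    intro k _
    by_contra! hlt
    obtain ⟨a, b, c, ha, hb, hc, hab, hac, hbc⟩ := Finset.two_lt_card_iff.1 hlt
    rw [Finset.mem_filter] at ha hb hc
    have h1 := hS a ha.1 b hb.1 c hc.1
    have h2 := hS b hb.1 c hc.1 a ha.1
    have h3 := hS c hc.1 a ha.1 b hb.1
    simp only [blockGraph_adj, ne_eq, Fin.ext_iff] at h1 h2 h3 hab hac hbc
    omega
  simpa using Finset.card_le_mul_card_image_of_maps_to hmaps 2 hfiber

lemma indequeMin_pathwidthAtMost_two_le (n : ℕ) :
    (pathwidthAtMost 2).indequeMin n ≤ 2 * (n / 4 + 1) := by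
  have hle : (pathwidthAtMost 2).indequeMin n ≤ (blockGraph n).indequeNumber :=
    Nat.sInf_le ⟨Fin n, inferInstance, blockGraph n, pathwidth_blockGraph_le n,
      Fintype.card_fin n, rfl⟩
  exact hle.trans (indequeNumber_blockGraph_le n)

lemma half_le_indequeMin_pathwidthAtMost_two (n : ℕ) :
    (n : ℝ) / 2 ≤ (pathwidthAtMost 2).indequeMin n := by
  have hne : {k : ℕ | ∃ (V : Type) (_ : Fintype V) (G : SimpleGraph V),
      G ∈ pathwidthAtMost 2 V ∧ Fintype.card V = n ∧ G.indequeNumber = k}.Nonempty :=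
    ⟨_, Fin n, inferInstance, blockGraph n, pathwidth_blockGraph_le n, Fintype.card_fin n, rfl⟩
  obtain ⟨V, _, G, hG, hV, hk⟩ := Nat.sInf_mem hne
  obtain ⟨S, hS, hcard⟩ := SimpleGraph.exists_isIndeque_of_pathwidth_le_two hG
  rw [hV] at hcard
  rw [GraphClass.indequeMin, ← hk]
  exact hcard.trans (by exact_mod_cast SimpleGraph.le_indequeNumber hS)

lemma hasIndequeRatio_pathwidthAtMost_two : (pathwidthAtMost 2).HasIndequeRatio (1 / 2) := by
  have hlim : Tendsto (fun n : ℕ => (1 / 2 : ℝ) + 2 / (n : ℝ)) atTop (𝓝 (1 / 2)) := by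
    simpa only [add_zero] using
      (tendsto_const_div_atTop_nhds_zero_nat (2 : ℝ)).const_add (1 / 2)
  refine tendsto_of_tendsto_of_tendsto_of_le_of_le' tendsto_const_nhds hlim ?_ ?_
  · filter_upwards [eventually_gt_atTop 0] with n hn
    have hn' : (0 : ℝ) < n := by exact_mod_cast hn
    rw [le_div_iff₀ hn']
    linarith [half_le_indequeMin_pathwidthAtMost_two n]
  · filter_upwards [eventually_gt_atTop 0] with n hn
    have hn' : (0 : ℝ) < n := by exact_mod_cast hn
    have h : 2 * (pathwidthAtMost 2).indequeMin n ≤ n + 4 := by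
      have := indequeMin_pathwidthAtMost_two_le n
      omega
    have h' : 2 * ((pathwidthAtMost 2).indequeMin n : ℝ) ≤ n + 4 := by exact_mod_cast h
    rw [div_le_iff₀ hn', add_mul, div_mul_cancel₀ _ hn'.ne']
    linarith

/-! ### The 4-cycle -/

/-- The `4`-cycle has the bags `{0, 1, 3}` and `{1, 2, 3}`. -/
def cycleGraphFourDecomposition : (SimpleGraph.cycleGraph 4).PathDecomposition where
  len := 1
  bag := ![{0, 1, 3}, {1, 2, 3}]
  vertex_mem := by decide
  edge_mem := by decide
  interval := by decide

lemma indequeNumber_cycleGraph_four : (SimpleGraph.cycleGraph 4).indequeNumber = 2 := by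
  apply le_antisymm
  · refine SimpleGraph.indequeNumber_le fun S hS => ?_
    rw [SimpleGraph.isIndeque_iff] at hS
    by_contra! hlt
    obtain ⟨a, b, c, ha, hb, hc, hab, hac, hbc⟩ := Finset.two_lt_card_iff.1 hlt
    have key : ∀ a b c : Fin 4, a ≠ b → a ≠ c → b ≠ c →
        ((SimpleGraph.cycleGraph 4).Adj a b → (SimpleGraph.cycleGraph 4).Adj b c → a ≠ c →
          (SimpleGraph.cycleGraph 4).Adj a c) →
        ((SimpleGraph.cycleGraph 4).Adj b c → (SimpleGraph.cycleGraph 4).Adj c a → b ≠ a →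
          (SimpleGraph.cycleGraph 4).Adj b a) →
        ((SimpleGraph.cycleGraph 4).Adj c a → (SimpleGraph.cycleGraph 4).Adj a b → c ≠ b →
          (SimpleGraph.cycleGraph 4).Adj c b) → False := by
      decide
    exact key a b c hab hac hbc (hS a ha b hb c hc) (hS b hb c hc a ha) (hS c hc a ha b hb)
  · have h : (SimpleGraph.cycleGraph 4).IsIndeque (({0, 1} : Finset (Fin 4)) : Set (Fin 4)) := by
      rw [SimpleGraph.isIndeque_iff]
      simp only [Finset.mem_coe]
      decide
    exact SimpleGraph.le_indequeNumber h

theorem mainTheorem1 :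
    (pathwidthAtMost 2).HasIndequeRatio (1 / 2) ∧
    (∀ (V : Type*) [Fintype V] (G : SimpleGraph V), G.pathwidth ≤ 2 →
      ∃ S : Finset V, G.IsIndeque (S : Set V) ∧ (Fintype.card V : ℝ) / 2 ≤ (S.card : ℝ)) ∧
    ((SimpleGraph.cycleGraph 4).pathwidth ≤ 2 ∧
      (SimpleGraph.cycleGraph 4).indequeNumber = 2) :=
  ⟨hasIndequeRatio_pathwidthAtMost_two,
    fun _ _ _ h => SimpleGraph.exists_isIndeque_of_pathwidth_le_two h,
    cycleGraphFourDecomposition.pathwidth_le (by decide), indequeNumber_cycleGraph_four⟩
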